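/- Let $\mathbb H=\{x+iy: y>0\}$ with closure $\overline{\mathbb H}=\{x+iy:y\ge 0\}$, let $\alpha\in\mathbb C$ with $\operatorname{Im}\alpha\le 0$, let $U\subset\mathbb C$ be a simply connected domain containing $\overline{\mathbb H}\setminus\{\alpha\}$, and let $f:U\to\mathbb C$ be an injective holomorphic function such that $f(\overline{\mathbb H}\setminus\{\alpha\})$ is convex; let $f^{-1}:f(U)\to U$ denote its inverse. Let $X_1,X_2,\dots$ be i.i.d. random variables on a probability space with values in $\overline{\mathbb H}$ (for example, real-valued) which are continuous, that is, $P(X_1=z)=0$ for every $z\in\mathbb C$, and suppose that $E[|f(X_1)|^2]<\infty$. Then $f(X_1)$ is integrable, $E[f(X_1)]\in f(\overline{\mathbb H}\setminus\{\alpha\})$, almost surely $\frac1n\sum_{j=1}^n f(X_j)\in f(\overline{\mathbb H}\setminus\{\alpha\})$ for every $n\ge1$, and $f^{-1}$, regarded as a map between subsets of $\mathbb R^2\cong\mathbb C$, is differentiable at $E[f(X_1)]$. Moreover, identifying $\mathbb C$ with $\mathbb R^2$ through $x+iy\leftrightarrow(x,y)$, as $n\to\infty$, $$\sqrt n\left(f^{-1}\Big(\frac1n\sum_{j=1}^n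 f(X_j)\Big)-f^{-1}\big(E[f(X_1)]\big)\right)\Rightarrow N\big(0,\;J\,\mathrm{Cov}(f(X_1))\,J^{\top}\big)$$ in distribution, where $N(0,\Sigma)$ is the (possibly degenerate) two-dimensional normal distribution with mean $0$ and covariance matrix $\Sigma$, $$J=\begin{pmatrix}\frac{\partial \operatorname{Re}(f^{-1})}{\partial x}&\frac{\partial \operatorname{Re}(f^{-1})}{\partial y}\\[2pt] \frac{\partial \operatorname{Im}(f^{-1})}{\partial x}&\frac{\partial \operatorname{Im}(f^{-1})}{\partial y}\end{pmatrix}\Bigg|_{E[f(X_1)]},$$ and $$\mathrm{Cov}(f(X_1))=\begin{pmatrix}\mathrm{Var}(\operatorname{Re}f(X_1))&\mathrm{Cov}(\operatorname{Re}f(X_1),\operatorname{Im}f(X_1))\\ \mathrm{Cov}(\operatorname{Re}f(X_1),\operatorname{Im}f(X_1))&\mathrm{Var}(\operatorname{Im}f(X_1))\end{pmatrix}.$$ -/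

import Mathlib

open MeasureTheory ProbabilityTheory Filter Topology

noncomputable section

/-- The closed upper half-plane with the point `α` removed. -/
def puncturedClosedUpperHalfPlane (α : ℂ) : Set ℂ :=
  {z : ℂ | 0 ≤ z.im} \ {α}

/-- `f` is a generator of a quasi-arithmetic mean: `α` lies in the closed lower half-plane, `U` is a
simply connected domain containing the closed upper half-plane without `α`, and `f` is an injective
holomorphic function on `U` which maps the closed upper half-plane without `α` onto a convex set.
(The values of `f` outside `U` play no role.) -/
structure IsMeanGenerator (α : ℂ) (U : Set ℂ) (f : ℂ → ℂ) : Prop where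
  im_nonpos : α.im ≤ 0
  isOpen : IsOpen U
  isSimplyConnected : IsSimplyConnected U
  subset : puncturedClosedUpperHalfPlane α ⊆ U
  injOn : Set.InjOn f U
  differentiableOn : DifferentiableOn ℂ f U
  convex_image : Convex ℝ (f '' puncturedClosedUpperHalfPlane α)

/-- The inverse function `f⁻¹ : f(U) → U`, extended arbitrarily outside `f(U)`. -/
def generatorInv (U : Set ℂ) (f : ℂ → ℂ) : ℂ → ℂ :=
  Function.invFunOn f U

/-- The arithmetic mean `(1/n) ∑ f(x_j)` of the first `n` terms of the sequence `f(x_0), f(x_1), …`. -/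
def generatorAverage (f : ℂ → ℂ) (x : ℕ → ℂ) (n : ℕ) : ℂ :=
  (1 / (n : ℂ)) * ∑ j ∈ Finset.range n, f (x j)

/-- The `f`-mean `f⁻¹((1/n) ∑ f(x_j))` of the first `n` terms of the sequence `x`. -/
def quasiArithmeticMean (U : Set ℂ) (f : ℂ → ℂ) (x : ℕ → ℂ) (n : ℕ) : ℂ :=
  generatorInv U f (generatorAverage f x n)

/-- The Jacobi matrix at `w` of `g : ℂ → ℂ` seen as a map `ℝ² → ℝ²`: the partial derivatives in `x`
and `y` are the derivatives in the directions `1` and `I`. -/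
def realJacobian (g : ℂ → ℂ) (w : ℂ) : Matrix (Fin 2) (Fin 2) ℝ :=
  !![lineDeriv ℝ (fun z => (g z).re) w 1, lineDeriv ℝ (fun z => (g z).re) w Complex.I;
     lineDeriv ℝ (fun z => (g z).im) w 1, lineDeriv ℝ (fun z => (g z).im) w Complex.I]

/-- The covariance matrix of a complex random variable seen as an `ℝ²`-valued one. -/
def complexCovMatrix {Ω : Type*} [MeasurableSpace Ω] (P : Measure Ω) (Y : Ω → ℂ) :
    Matrix (Fin 2) (Fin 2) ℝ :=
  !![variance (fun ω => (Y ω).re) P, covariance (fun ω => (Y ω).re) (fun ω => (Y ω).im) P;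
     covariance (fun ω => (Y ω).re) (fun ω => (Y ω).im) P, variance (fun ω => (Y ω).im) P]

/-- The identification `x + iy ↦ (x, y)` of `ℂ` with `ℝ²`. -/
def complexToPlane (z : ℂ) : EuclideanSpace ℝ (Fin 2) :=
  !₂[z.re, z.im]

end

/-! The inverse `g` of `f` is holomorphic on the open set `f '' U`, so the claim is the delta method
for `g` applied to the averages `A n` of the `f (X j)`, with mean `m`. Exactly, `g (A n) - g m =
dslope g m (A n) * (A n - m)`. The strong law sends the slope to `deriv g m`, the planar central
limit theorem governs `√n (A n - m)`, and Slutsky's lemma combines them. Multiplication by `deriv g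
m` is the real Jacobian `J`, and turns covariance `S` into `J S Jᵀ`.

The delicate point is that `m` lies in the convex image, which need not be closed. Otherwise a
supporting line through `m` would carry almost all the mass, and on a line the mean of a
convex-set-valued variable stays in the set. -/

/-! ### The inverse of an injective holomorphic function -/

section Inverse

variable {U : Set ℂ} {f : ℂ → ℂ}

/-- An injective holomorphic function is open at every point of its domain. -/
theorem nhds_le_map_of_injOn (hU : IsOpen U) (hf : DifferentiableOn ℂ f U) (hinj : U.InjOn f)
    {z : ℂ} (hz : z ∈ U) : 𝓝 (f z) ≤ map f (𝓝 z) := by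
  -- Local constancy contradicts injectivity because `z` is not isolated.
  refine (hf.analyticAt (hU.mem_nhds hz)).eventually_constant_or_nhds_le_map_nhds.resolve_left ?_
  intro h
  have h' : ∀ᶠ w in 𝓝 z, w = z := by
    filter_upwards [h, hU.mem_nhds hz] with w hw hwU using hinj hwU hz hw
  obtain ⟨w, hw, hne⟩ :=
    ((h'.filter_mono nhdsWithin_le_nhds).and (self_mem_nhdsWithin : {z}ᶜ ∈ 𝓝[≠] z)).exists
  exact hne hw

theorem isOpen_image_of_injOn (hU : IsOpen U) (hf : DifferentiableOn ℂ f U) (hinj : U.InjOn f) :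
    IsOpen (f '' U) := by
  rw [isOpen_iff_mem_nhds]
  rintro _ ⟨z, hz, rfl⟩
  exact nhds_le_map_of_injOn hU hf hinj hz (image_mem_map (hU.mem_nhds hz))

theorem continuousAt_invFunOn (hU : IsOpen U) (hf : DifferentiableOn ℂ f U) (hinj : U.InjOn f)
    {z : ℂ} (hz : z ∈ U) : ContinuousAt (Function.invFunOn f U) (f z) := by
  have hleft := hinj.leftInvOn_invFunOn
  have h : Tendsto (Function.invFunOn f U) (map f (𝓝 z)) (𝓝 z) := by
    rw [tendsto_map'_iff]
    refine tendsto_id.congr' ?_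
    filter_upwards [hU.mem_nhds hz] with w hw using (hleft hw).symm
  rw [ContinuousAt, hleft hz]
  exact h.mono_left (nhds_le_map_of_injOn hU hf hinj hz)

theorem continuousOn_invFunOn (hU : IsOpen U) (hf : DifferentiableOn ℂ f U) (hinj : U.InjOn f) :
    ContinuousOn (Function.invFunOn f U) (f '' U) := by
  rintro _ ⟨z, hz, rfl⟩
  exact (continuousAt_invFunOn hU hf hinj hz).continuousWithinAt

/-- The critical points of an injective holomorphic function are isolated. -/
theorem eventually_deriv_ne_zero_of_injOn (hU : IsOpen U) (hf : DifferentiableOn ℂ f U)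
    (hinj : U.InjOn f) {z : ℂ} (hz : z ∈ U) : ∀ᶠ w in 𝓝[≠] z, deriv f w ≠ 0 := by
  refine (hf.analyticAt (hU.mem_nhds hz)).deriv.eventually_eq_zero_or_eventually_ne_zero.resolve_left
    fun h ↦ ?_
  obtain ⟨r, hr, hball⟩ := Metric.eventually_nhds_iff_ball.1 (h.and (hU.mem_nhds hz))
  have hev : ∀ᶠ w in 𝓝[≠] z, w ∈ Metric.ball z r :=
    nhdsWithin_le_nhds (Metric.ball_mem_nhds z hr)
  obtain ⟨w, hw, hne⟩ := (hev.and (self_mem_nhdsWithin : {z}ᶜ ∈ 𝓝[≠] z)).exists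
  have hzr := Metric.mem_ball_self (x := z) hr
  have hconst := Metric.isOpen_ball.is_const_of_deriv_eq_zero
    (convex_ball z r).isPreconnected (hf.mono fun x hx ↦ (hball x hx).2)
    (fun x hx ↦ (hball x hx).1) hw hzr
  exact hne (hinj (hball w hw).2 hz hconst)

theorem differentiableAt_invFunOn_of_deriv_ne_zero (hU : IsOpen U) (hf : DifferentiableOn ℂ f U)
    (hinj : U.InjOn f) {z : ℂ} (hz : z ∈ U) (hne : deriv f z ≠ 0) :
    DifferentiableAt ℂ (Function.invFunOn f U) (f z) := by
  have hleft := hinj.leftInvOn_invFunOn hz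
  refine (HasDerivAt.of_local_left_inverse (f := f) (f' := deriv f z)
    (continuousAt_invFunOn hU hf hinj hz) ?_ hne ?_).differentiableAt
  · rw [hleft]
    exact ((hf z hz).differentiableAt (hU.mem_nhds hz)).hasDerivAt
  · filter_upwards [(isOpen_image_of_injOn hU hf hinj).mem_nhds (Set.mem_image_of_mem f hz)]
      with y hy using Function.invFunOn_eq hy

/-- The inverse of an injective holomorphic function is holomorphic. -/
theorem differentiableAt_invFunOn (hU : IsOpen U) (hf : DifferentiableOn ℂ f U)
    (hinj : U.InjOn f) {z : ℂ} (hz : z ∈ U) :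
    DifferentiableAt ℂ (Function.invFunOn f U) (f z) := by
  -- The inverse is holomorphic on a punctured neighbourhood of `f z` and continuous at `f z`, so
  -- the singularity is removable; `deriv f z ≠ 0` is never needed.
  set N : Set ℂ := {w | w ∈ U ∧ (w ≠ z → deriv f w ≠ 0)}
  have hN : N ∈ 𝓝 z := (hU.eventually_mem hz).and
    (eventually_nhdsWithin_iff.1 (eventually_deriv_ne_zero_of_injOn hU hf hinj hz))
  have hfN : f '' N ∈ 𝓝 (f z) := nhds_le_map_of_injOn hU hf hinj hz (image_mem_map hN)
  refine ((Complex.differentiableOn_compl_singleton_and_continuousAt_iff hfN).1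
    ⟨?_, continuousAt_invFunOn hU hf hinj hz⟩).differentiableAt hfN
  rintro _ ⟨⟨w, hw, rfl⟩, hne⟩
  exact (differentiableAt_invFunOn_of_deriv_ne_zero hU hf hinj hw.1
    (hw.2 fun h ↦ hne (congrArg f h))).differentiableWithinAt

end Inverse

/-! ### Expectations of random variables with values in a convex set -/

section Convex

variable {Ω : Type*} [MeasurableSpace Ω] {P : Measure Ω} [IsProbabilityMeasure P]

/-- Off a null set `T` takes a value on each side of its mean, and `s` is an interval. -/
theorem Convex.integral_mem_real {s : Set ℝ} (hs : Convex ℝ s) {T : Ω → ℝ}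
    (hT : ∀ᵐ ω ∂P, T ω ∈ s) (hint : Integrable T P) : ∫ ω, T ω ∂P ∈ s := by
  obtain ⟨x, hx, hxE⟩ := exists_notMem_null_le_integral hint hT
  obtain ⟨y, hy, hyE⟩ := exists_notMem_null_integral_le hint hT
  exact hs.ordConnected.out (not_not.1 hx) (not_not.1 hy) ⟨hxE, hyE⟩

/-- The expectation of a random variable with values in a planar convex set with nonempty interior
belongs to this set, which need not be closed. -/
theorem Convex.integral_mem_of_interior_nonempty {s : Set ℂ} (hs : Convex ℝ s)
    (hne : (interior s).Nonempty) {Y : Ω → ℂ} (hY : ∀ᵐ ω ∂P, Y ω ∈ s) (hint : Integrable Y P) :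
    ∫ ω, Y ω ∂P ∈ s := by
  set m := ∫ ω, Y ω ∂P with hm
  by_contra hms
  obtain ⟨l, hl⟩ := geometric_hahn_banach_open_point hs.interior isOpen_interior
    (fun h ↦ hms (interior_subset h))
  have hle : ∀ z ∈ s, l z ≤ l m := by
    intro z hz
    have hz' : z ∈ closure (interior s) := by
      rw [hs.closure_interior_eq_closure_of_nonempty_interior hne]
      exact subset_closure hz
    exact closure_minimal (fun a ha ↦ (hl a ha).le)
      (isClosed_le l.continuous continuous_const) hz'
  have hlint : Integrable (fun ω ↦ l m - l (Y ω)) P :=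
    (integrable_const _).sub (l.integrable_comp hint)
  have hzero : ∫ ω, (l m - l (Y ω)) ∂P = 0 := by
    rw [integral_sub (integrable_const _) (l.integrable_comp hint),
      l.integral_comp_comm hint, ← hm]
    simp
  have hnonneg : 0 ≤ᵐ[P] fun ω ↦ l m - l (Y ω) := by
    filter_upwards [hY] with ω hω using sub_nonneg.2 (hle _ hω)
  -- Nonnegative with mean zero: `Y` lies almost surely on the supporting line through `m`.
  have hline := (integral_eq_zero_iff_of_nonneg_ae hnonneg hlint).1 hzero
  set a := l 1
  set b := l Complex.I
  have hlz : ∀ z : ℂ, l z = z.re * a + z.im * b := by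
    intro z
    conv_lhs => rw [← Complex.re_add_im z]
    rw [map_add, show (z.re : ℂ) = z.re • (1 : ℂ) by simp,
      show (z.im : ℂ) * Complex.I = z.im • Complex.I by simp, map_smul, map_smul]
    rfl
  have hab : 0 < a ^ 2 + b ^ 2 := by
    obtain ⟨z, hz⟩ := hne
    have h := hl z hz
    by_contra h0
    have ha : a = 0 := by nlinarith [sq_nonneg a, sq_nonneg b]
    have hb : b = 0 := by nlinarith [sq_nonneg a, sq_nonneg b]
    simp [hlz, ha, hb] at h
  -- `v` spans the kernel of `l`, and `T` is the coordinate of `Y - m` along `v`.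
  set v : ℂ := ⟨-b, a⟩
  set T : Ω → ℝ := fun ω ↦ (a ^ 2 + b ^ 2)⁻¹ * (a * (Y ω - m).im - b * (Y ω - m).re)
  have hYm : Integrable (fun ω ↦ Y ω - m) P := hint.sub (integrable_const m)
  have hYm0 : ∫ ω, (Y ω - m) ∂P = 0 := by
    rw [integral_sub hint (integrable_const m), ← hm]
    simp
  have hTint : Integrable T P :=
    ((hYm.im.const_mul a).sub (hYm.re.const_mul b)).const_mul _
  have hT0 : ∫ ω, T ω ∂P = 0 := by
    have hre : ∫ ω, (Y ω - m).re ∂P = 0 := by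
      have := integral_re hYm
      simp only [RCLike.re_to_complex] at this
      rw [this, hYm0, Complex.zero_re]
    have him : ∫ ω, (Y ω - m).im ∂P = 0 := by
      have := integral_im hYm
      simp only [RCLike.im_to_complex] at this
      rw [this, hYm0, Complex.zero_im]
    have hsub : ∫ ω, (a * (Y ω - m).im - b * (Y ω - m).re) ∂P
        = (∫ ω, a * (Y ω - m).im ∂P) - ∫ ω, b * (Y ω - m).re ∂P :=
      integral_sub (hYm.im.const_mul a) (hYm.re.const_mul b)
    simp only [T]
    rw [integral_const_mul, hsub, integral_const_mul, integral_const_mul, hre, him]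
    simp
  have hconv : Convex ℝ {t : ℝ | m + t • v ∈ s} := by
    have : {t : ℝ | m + t • v ∈ s} = (AffineMap.lineMap m (m + v) : ℝ →ᵃ[ℝ] ℂ) ⁻¹' s := by
      ext t
      simp [AffineMap.lineMap_apply, add_comm]
    rw [this]
    exact hs.affine_preimage _
  have hTs : ∀ᵐ ω ∂P, T ω ∈ {t : ℝ | m + t • v ∈ s} := by
    filter_upwards [hY, hline] with ω hω hlω
    have h0 : (Y ω - m).re * a + (Y ω - m).im * b = 0 := by
      rw [← hlz, map_sub]
      simp only [Pi.zero_apply] at hlω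
      linarith
    have hv : T ω • v = Y ω - m := by
      apply Complex.ext
      · simp only [Complex.real_smul, Complex.re_ofReal_mul, T, v]
        field_simp
        linear_combination (-a) * h0
      · simp only [Complex.real_smul, Complex.im_ofReal_mul, T, v]
        field_simp
        linear_combination (-b) * h0
    rwa [hv, add_sub_cancel]
  have := hconv.integral_mem_real hTs hTint
  rw [hT0] at this
  simp at this
  exact hms this

end Convex

/-! ### Planar Gaussian limits -/

section Gaussian

open scoped RealInnerProductSpace Matrix

variable {Ω : Type*} [MeasurableSpace Ω] {P : Measure Ω} [IsProbabilityMeasure P]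

theorem continuous_complexToPlane : Continuous complexToPlane := by
  unfold complexToPlane
  refine (PiLp.continuous_toLp 2 _).comp (continuous_pi fun i ↦ ?_)
  fin_cases i
  · exact Complex.continuous_re
  · exact Complex.continuous_im

theorem inner_complexToPlane (z : ℂ) (t : EuclideanSpace ℝ (Fin 2)) :
    ⟪complexToPlane z, t⟫ = t 0 * z.re + t 1 * z.im := by
  simp [complexToPlane, PiLp.inner_apply, Fin.sum_univ_two]

/-- Yields both positive semidefiniteness and the variance of each one-dimensional projection in the
limit theorem. -/
theorem variance_re_add_im {Y : Ω → ℂ} (hY : MemLp Y 2 P) (x : Fin 2 → ℝ) :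
    variance (fun ω ↦ x 0 * (Y ω).re + x 1 * (Y ω).im) P
      = x ⬝ᵥ (complexCovMatrix P Y).mulVec x := by
  have hre : MemLp (fun ω ↦ (Y ω).re) 2 P := hY.re
  have him : MemLp (fun ω ↦ (Y ω).im) 2 P := hY.im
  have h := variance_add (hre.const_mul (x 0)) (him.const_mul (x 1))
  rw [variance_const_mul, variance_const_mul, covariance_const_mul_left,
    covariance_const_mul_right] at h
  refine h.trans ?_
  simp [complexCovMatrix, Matrix.mulVec, dotProduct, Fin.sum_univ_two]
  ring

theorem posSemidef_complexCovMatrix {Y : Ω → ℂ} (hY : MemLp Y 2 P) :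
    (complexCovMatrix P Y).PosSemidef := by
  refine Matrix.PosSemidef.of_dotProduct_mulVec_nonneg ?_ fun x ↦ ?_
  · ext i j
    fin_cases i <;> fin_cases j <;> simp [complexCovMatrix]
  · rw [star_trivial, ← variance_re_add_im hY]
    exact variance_nonneg _ _

/-- The **central limit theorem** for complex random variables. -/
theorem tendstoInDistribution_complexToPlane {Y : ℕ → Ω → ℂ} (hindep : iIndepFun Y P)
    (hident : ∀ j, IdentDistrib (Y j) (Y 0) P P) (hY : MemLp (Y 0) 2 P) :
    TendstoInDistribution
      (fun (n : ℕ) ω ↦ complexToPlane ((Real.sqrt (n : ℝ) : ℂ) *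
        (generatorAverage id (fun j ↦ Y j ω) n - ∫ ω', Y 0 ω' ∂P)))
      atTop (id : EuclideanSpace ℝ (Fin 2) → EuclideanSpace ℝ (Fin 2)) (fun _ ↦ P)
      (multivariateGaussian 0 (complexCovMatrix P (Y 0))) := by
  have hmeas : ∀ n : ℕ, AEMeasurable (fun ω ↦ complexToPlane ((Real.sqrt (n : ℝ) : ℂ) *
      (generatorAverage id (fun j ↦ Y j ω) n - ∫ ω', Y 0 ω' ∂P))) P := by
    intro n
    have := fun j ↦ (hident j).aemeasurable_fst
    refine continuous_complexToPlane.measurable.comp_aemeasurable ?_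
    unfold generatorAverage
    simp only [id]
    fun_prop
  refine ⟨hmeas, aemeasurable_id, ?_⟩
  refine ProbabilityMeasure.tendsto_iff_tendsto_charFun.2 fun t ↦ ?_
  -- Cramér–Wold: the planar characteristic function at `t` is that of the projection by `l` at `1`,
  -- where the real central limit theorem applies.
  set l : ℂ →L[ℝ] ℝ := t 0 • Complex.reCLM + t 1 • Complex.imCLM
  have hl : ∀ z, l z = t 0 * z.re + t 1 * z.im := fun z ↦ by simp [l]
  have hlY : MemLp (l ∘ Y 0) 2 P := l.comp_memLp' hY
  have hclt := tendstoInDistribution_inv_sqrt_mul_sum_sub (X := fun j ↦ l ∘ Y j) (P := P)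
    HasLaw.id hlY (hindep.comp (fun _ ↦ l) fun _ ↦ l.measurable)
    (fun j ↦ (hident j).comp l.measurable)
  have hchar := ProbabilityMeasure.tendsto_iff_tendsto_charFun.1 hclt.tendsto 1
  have hE : ∫ ω, (l ∘ Y 0) ω ∂P = l (∫ ω, Y 0 ω ∂P) :=
    l.integral_comp_comm (hY.integrable (by norm_num))
  have hmul : ∀ (r : ℝ) (z : ℂ), l (r * z) = r * l z := fun r z ↦ by
    rw [← Complex.real_smul, map_smul, smul_eq_mul]
  have hV : ∀ (n : ℕ) ω, l ((Real.sqrt (n : ℝ) : ℂ) *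
      (generatorAverage id (fun j ↦ Y j ω) n - ∫ ω', Y 0 ω' ∂P))
      = (Real.sqrt n)⁻¹ * (∑ j ∈ Finset.range n, (l ∘ Y j) ω
          - n * ∫ ω', (l ∘ Y 0) ω' ∂P) := by
    intro n ω
    rw [hmul, map_sub, hE, generatorAverage,
      show (1 / (n : ℂ)) = ((1 / n : ℝ) : ℂ) by push_cast; rfl, hmul, map_sum]
    simp only [id, Function.comp_apply]
    rcases Nat.eq_zero_or_pos n with rfl | hn
    · simp
    have hn' : (0 : ℝ) < n := Nat.cast_pos.2 hn
    have hs : (0 : ℝ) < Real.sqrt n := Real.sqrt_pos.2 hn'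
    have hsq : Real.sqrt n ^ 2 = n := Real.sq_sqrt hn'.le
    field_simp
    rw [hsq]
  have hlim : charFun ((gaussianReal 0 (variance (l ∘ Y 0) P).toNNReal).map id) 1
      = charFun ((multivariateGaussian 0 (complexCovMatrix P (Y 0))).map id) t := by
    have hvar : variance (l ∘ Y 0) P
        = t ⬝ᵥ (complexCovMatrix P (Y 0)).mulVec t := by
      rw [← variance_re_add_im hY]
      exact congrArg (variance · P) (funext fun ω ↦ hl _)
    rw [Measure.map_id, Measure.map_id, charFun_gaussianReal,
      charFun_multivariateGaussian (posSemidef_complexCovMatrix hY),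
      Real.coe_toNNReal _ (variance_nonneg _ _), hvar]
    simp
  refine (hchar.congr fun n ↦ ?_).trans (le_of_eq (congrArg 𝓝 hlim))
  simp only [ProbabilityMeasure.coe_mk]
  rw [charFun_apply, charFun_apply, integral_map (hclt.forall_aemeasurable n) (by fun_prop),
    integral_map (hmeas n) (by fun_prop)]
  simp only [inner_complexToPlane, ← hl, hV]
  simp

end Gaussian

/-! ### Linear images of Gaussian measures -/

section Map

open scoped RealInnerProductSpace Matrix

theorem multivariateGaussian_map_toEuclideanCLM {ι : Type*} [Fintype ι] [DecidableEq ι]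
    {S : Matrix ι ι ℝ} (hS : S.PosSemidef) (A : Matrix ι ι ℝ) :
    (multivariateGaussian 0 S).map (Matrix.toEuclideanCLM (𝕜 := ℝ) A)
      = multivariateGaussian 0 (A * S * A.transpose) := by
  have hS' : (A * S * A.transpose).PosSemidef := by
    simpa using hS.mul_mul_conjTranspose_same A
  refine Measure.ext_of_charFun (funext fun t ↦ ?_)
  rw [charFun_multivariateGaussian hS', charFun_apply, integral_map (by fun_prop) (by fun_prop)]
  have h : ∀ x, ⟪Matrix.toEuclideanCLM (𝕜 := ℝ) A x, t⟫
      = ⟪x, WithLp.toLp 2 (A.transpose *ᵥ t.ofLp)⟫ := by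
    intro x
    rw [real_inner_comm, Matrix.inner_toEuclideanCLM, EuclideanSpace.inner_eq_star_dotProduct,
      Matrix.dotProduct_mulVec, ← Matrix.mulVec_transpose]
    simp
  simp_rw [h]
  rw [← charFun_apply, charFun_multivariateGaussian hS]
  congr 3
  · simp
  · rw [← Matrix.mulVec_mulVec, ← Matrix.mulVec_mulVec, Matrix.dotProduct_mulVec t.ofLp A,
      ← Matrix.mulVec_transpose]

end Map

/-! ### The delta method -/

section Delta

open scoped Matrix

theorem realJacobian_eq {g : ℂ → ℂ} {w c : ℂ} (h : HasDerivAt g c w) :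
    realJacobian g w = !![c.re, -c.im; c.im, c.re] := by
  have hF := h.hasFDerivAt.restrictScalars ℝ
  have hre (v : ℂ) := ((Complex.reCLM.hasFDerivAt.comp w hF).hasLineDerivAt v).lineDeriv
  have him (v : ℂ) := ((Complex.imCLM.hasFDerivAt.comp w hF).hasLineDerivAt v).lineDeriv
  have hre' : (⇑Complex.reCLM ∘ g) = fun z ↦ (g z).re := rfl
  have him' : (⇑Complex.imCLM ∘ g) = fun z ↦ (g z).im := rfl
  rw [hre'] at hre
  rw [him'] at him
  simp [realJacobian, hre, him]

/-- The real Jacobian of a holomorphic function acts as multiplication by its derivative. -/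
theorem toEuclideanCLM_realJacobian {g : ℂ → ℂ} {w c : ℂ} (h : HasDerivAt g c w)
    (x : EuclideanSpace ℝ (Fin 2)) :
    Matrix.toEuclideanCLM (𝕜 := ℝ) (realJacobian g w) x = complexToPlane (c * ⟨x 0, x 1⟩) := by
  rw [realJacobian_eq h]
  ext i
  fin_cases i <;>
    simp [complexToPlane, Matrix.ofLp_toEuclideanCLM, Matrix.mulVec, dotProduct,
      Fin.sum_univ_two] <;> ring

variable {Ω : Type*} [MeasurableSpace Ω] {P : Measure Ω}

theorem ContinuousOn.aemeasurable_comp {h : ℂ → ℂ} {V : Set ℂ} (hh : ContinuousOn h V)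
    (hV : IsOpen V) {Y : Ω → ℂ} (hY : AEMeasurable Y P) (hYV : ∀ᵐ ω ∂P, Y ω ∈ V) :
    AEMeasurable (fun ω ↦ h (Y ω)) P := by
  classical
  have hm : Measurable (V.piecewise h 0) :=
    hh.measurable_piecewise continuousOn_const hV.measurableSet
  refine (hm.comp_aemeasurable hY).congr ?_
  filter_upwards [hYV] with ω hω
  exact Set.piecewise_eq_of_mem V h 0 hω

variable [IsProbabilityMeasure P]

theorem TendstoInDistribution.of_map_eq {E Ω' : Type*} [MeasurableSpace Ω'] [TopologicalSpace E]
    [MeasurableSpace E] [OpensMeasurableSpace E] {μ : Measure Ω'} [IsProbabilityMeasure μ]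
    {ν : Measure E} [IsProbabilityMeasure ν] {X : ℕ → Ω → E} {Z : Ω' → E}
    (h : TendstoInDistribution X atTop Z (fun _ ↦ P) μ) (hν : μ.map Z = ν) :
    TendstoInDistribution X atTop id (fun _ ↦ P) ν := by
  refine ⟨h.forall_aemeasurable, aemeasurable_id, ?_⟩
  refine h.tendsto.trans (le_of_eq (congrArg 𝓝 (Subtype.ext ?_)))
  exact hν.trans Measure.map_id.symm

/-- The **delta method** for averages of i.i.d. complex random variables and a function which is
complex differentiable at the expectation. -/
theorem tendstoInDistribution_delta {Y : ℕ → Ω → ℂ} (hindep : iIndepFun Y P)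
    (hident : ∀ j, IdentDistrib (Y j) (Y 0) P P) (hY : MemLp (Y 0) 2 P) {g : ℂ → ℂ} {V : Set ℂ}
    (hV : IsOpen V) (hg : ContinuousOn g V) (hm : ∫ ω, Y 0 ω ∂P ∈ V)
    (hd : DifferentiableAt ℂ g (∫ ω, Y 0 ω ∂P))
    (hYV : ∀ n : ℕ, 1 ≤ n → ∀ᵐ ω ∂P, generatorAverage id (fun j ↦ Y j ω) n ∈ V) :
    TendstoInDistribution
      (fun (n : ℕ) ω ↦ complexToPlane ((Real.sqrt (n : ℝ) : ℂ) *
        (g (generatorAverage id (fun j ↦ Y j ω) n) - g (∫ ω', Y 0 ω' ∂P))))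
      atTop (id : EuclideanSpace ℝ (Fin 2) → EuclideanSpace ℝ (Fin 2)) (fun _ ↦ P)
      (multivariateGaussian 0 (realJacobian g (∫ ω, Y 0 ω ∂P) * complexCovMatrix P (Y 0)
        * (realJacobian g (∫ ω, Y 0 ω ∂P)).transpose)) := by
  set m := ∫ ω, Y 0 ω ∂P
  set A : ℕ → Ω → ℂ := fun n ω ↦ generatorAverage id (fun j ↦ Y j ω) n
  have hA : ∀ n, AEMeasurable (A n) P := by
    intro n
    have := fun j ↦ (hident j).aemeasurable_fst
    simp only [A, generatorAverage, id]
    fun_prop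
  have hslope : ContinuousOn (dslope g m) V :=
    (continuousOn_dslope (hV.mem_nhds hm)).2 ⟨hg, hd⟩
  have hSm : ∀ n, AEMeasurable (fun ω ↦ dslope g m (A n ω)) P := by
    intro n
    -- The empty average is `0`, possibly outside `V`, but then the slope is constant in `ω`.
    rcases Nat.eq_zero_or_pos n with rfl | hn
    · simp only [A, generatorAverage, Finset.range_zero, Finset.sum_empty, mul_zero]
      exact aemeasurable_const
    · exact hslope.aemeasurable_comp hV (hA n) (hYV n hn)
  have hSlim : TendstoInMeasure P (fun n ω ↦ dslope g m (A n ω)) atTop (fun _ ↦ deriv g m) := by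
    refine tendstoInMeasure_of_tendsto_ae (fun n ↦ (hSm n).aestronglyMeasurable) ?_
    filter_upwards [strong_law_ae Y (hY.integrable (by norm_num))
      (fun i j hij ↦ hindep.indepFun hij) hident] with ω hω
    have hAm : Tendsto (fun n ↦ A n ω) atTop (𝓝 m) := by
      refine hω.congr fun n ↦ ?_
      simp [A, generatorAverage]
    rw [← dslope_same]
    exact (hslope.continuousAt (hV.mem_nhds hm)).tendsto.comp hAm
  have hG : Continuous (fun p : EuclideanSpace ℝ (Fin 2) × ℂ ↦
      complexToPlane (p.2 * ⟨p.1 0, p.1 1⟩)) := by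
    refine continuous_complexToPlane.comp (continuous_snd.mul ?_)
    have : Continuous fun p : EuclideanSpace ℝ (Fin 2) × ℂ ↦
        ((p.1 0 : ℂ) + (p.1 1 : ℂ) * Complex.I) := by fun_prop
    simpa only [Complex.mk_eq_add_mul_I] using this
  have hclt := tendstoInDistribution_complexToPlane hindep hident hY
  have hslutsky := hclt.continuous_comp_prodMk_of_tendstoInMeasure_const hG hSlim hSm
  refine TendstoInDistribution.of_map_eq
    (hslutsky.congr (fun n ↦ .of_forall fun ω ↦ ?_) EventuallyEq.rfl) ?_
  · have h := sub_smul_dslope g m (A n ω)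
    simp only [smul_eq_mul] at h
    change complexToPlane _ = complexToPlane _
    congr 1
    change dslope g m (A n ω) * ((Real.sqrt (n : ℝ) : ℂ) * (A n ω - m)) = _
    rw [← h]
    ring
  · rw [← multivariateGaussian_map_toEuclideanCLM (posSemidef_complexCovMatrix hY)]
    exact congrArg (Measure.map · _)
      (funext fun x ↦ (toEuclideanCLM_realJacobian hd.hasDerivAt x).symm)

end Delta

/-! ### Application to quasi-arithmetic means -/

theorem theorem1p4 {Ω : Type*} [MeasurableSpace Ω] (P : Measure Ω) [IsProbabilityMeasure P]
    (α : ℂ) (U : Set ℂ) (f : ℂ → ℂ) (hf : IsMeanGenerator α U f)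
    (X : ℕ → Ω → ℂ)
    (hX_indep : iIndepFun X P)
    (hX_ident : ∀ j, IdentDistrib (X j) (X 0) P P)
    (hX_mem : ∀ j, ∀ᵐ ω ∂P, 0 ≤ (X j ω).im)
    (hX_cont : ∀ z : ℂ, P {ω | X 0 ω = z} = 0)
    (hX_sq : Integrable (fun ω => ‖f (X 0 ω)‖ ^ 2) P) :
    Integrable (fun ω => f (X 0 ω)) P ∧
    (∫ ω, f (X 0 ω) ∂P) ∈ f '' puncturedClosedUpperHalfPlane α ∧
    (∀ᵐ ω ∂P, ∀ n : ℕ, 1 ≤ n →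
      generatorAverage f (fun j => X j ω) n ∈ f '' puncturedClosedUpperHalfPlane α) ∧
    DifferentiableAt ℝ (generatorInv U f) (∫ ω, f (X 0 ω) ∂P) ∧
    TendstoInDistribution
      (fun (n : ℕ) (ω : Ω) => complexToPlane
        ((Real.sqrt (n : ℝ) : ℂ) * (quasiArithmeticMean U f (fun j => X j ω) n
          - generatorInv U f (∫ ω', f (X 0 ω') ∂P))))
      atTop
      (id : EuclideanSpace ℝ (Fin 2) → EuclideanSpace ℝ (Fin 2))
      (fun _ => P)
      (multivariateGaussian 0
        (realJacobian (generatorInv U f) (∫ ω, f (X 0 ω) ∂P)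
          * complexCovMatrix P (fun ω => f (X 0 ω))
          * (realJacobian (generatorInv U f) (∫ ω, f (X 0 ω) ∂P)).transpose)) := by
  classical
  set C := f '' puncturedClosedUpperHalfPlane α
  have hV := isOpen_image_of_injOn hf.isOpen hf.differentiableOn hf.injOn
  have hCV : C ⊆ f '' U := Set.image_mono hf.subset
  have hXmeas (j : ℕ) : AEMeasurable (X j) P := (hX_ident j).aemeasurable_fst
  have hXmem (j : ℕ) : ∀ᵐ ω ∂P, X j ω ∈ puncturedClosedUpperHalfPlane α := by
    -- Absence of atoms serves only to avoid `α`.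
    have h0 : ∀ᵐ ω ∂P, X 0 ω ∈ ({α}ᶜ : Set ℂ) := by
      rw [ae_iff]
      simpa using hX_cont α
    filter_upwards [hX_mem j, (hX_ident j).symm.ae_snd (measurableSet_singleton α).compl h0]
      with ω h1 h2 using ⟨h1, h2⟩
  -- `f` is arbitrary off `U`, so a measurable modification carries independence and equality of
  -- laws over to `f (X j)`.
  obtain ⟨F, hFm, hF⟩ : ∃ F : ℂ → ℂ, Measurable F ∧ Set.EqOn F f U :=
    ⟨U.piecewise f 0, hf.differentiableOn.continuousOn.measurable_piecewise continuousOn_const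
      hf.isOpen.measurableSet, Set.piecewise_eqOn U f 0⟩
  have hFX (j : ℕ) : F ∘ X j =ᵐ[P] fun ω ↦ f (X j ω) := by
    filter_upwards [hXmem j] with ω hω using hF (hf.subset hω)
  have hindep : iIndepFun (fun j ω ↦ f (X j ω)) P :=
    (hX_indep.comp (fun _ ↦ F) fun _ ↦ hFm).congr hFX
  have hYmeas (j : ℕ) : AEMeasurable (fun ω ↦ f (X j ω)) P :=
    (hFm.comp_aemeasurable (hXmeas j)).congr (hFX j)
  have hident (j : ℕ) : IdentDistrib (fun ω ↦ f (X j ω)) (fun ω ↦ f (X 0 ω)) P P :=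
    ⟨hYmeas j, hYmeas 0, by
      rw [← Measure.map_congr (hFX j), ← Measure.map_congr (hFX 0)]
      exact ((hX_ident j).comp hFm).map_eq⟩
  have hL2 : MemLp (fun ω ↦ f (X 0 ω)) 2 P :=
    (memLp_two_iff_integrable_sq_norm (hYmeas 0).aestronglyMeasurable).2 hX_sq
  have hint : Integrable (fun ω ↦ f (X 0 ω)) P := hL2.integrable (by norm_num)
  have hinterior : (interior C).Nonempty := by
    set z : ℂ := Complex.I
    have hz : z ∈ {w : ℂ | 0 < w.im} \ {α} := by
      refine ⟨by simp [z], fun h ↦ ?_⟩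
      have := hf.im_nonpos
      rw [← Set.mem_singleton_iff.1 h] at this
      norm_num [z] at this
    have hopen : IsOpen ({w : ℂ | 0 < w.im} \ {α}) :=
      (isOpen_lt continuous_const Complex.continuous_im).sdiff isClosed_singleton
    have hsub : {w : ℂ | 0 < w.im} \ {α} ⊆ puncturedClosedUpperHalfPlane α :=
      fun w hw ↦ ⟨(show 0 < w.im from hw.1).le, hw.2⟩
    refine ⟨f z, mem_interior_iff_mem_nhds.2 ?_⟩
    refine nhds_le_map_of_injOn hf.isOpen hf.differentiableOn hf.injOn (hf.subset (hsub hz)) ?_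
    exact mem_of_superset (image_mem_map (hopen.mem_nhds hz)) (Set.image_mono hsub)
  have hmean : (∫ ω, f (X 0 ω) ∂P) ∈ C := by
    refine hf.convex_image.integral_mem_of_interior_nonempty hinterior ?_ hint
    filter_upwards [hXmem 0] with ω hω using Set.mem_image_of_mem f hω
  have havg : ∀ᵐ ω ∂P, ∀ n : ℕ, 1 ≤ n → generatorAverage f (fun j ↦ X j ω) n ∈ C := by
    filter_upwards [ae_all_iff.2 hXmem] with ω hω n hn
    have hn0 : (n : ℝ) ≠ 0 := by positivity
    have := hf.convex_image.sum_mem (t := Finset.range n) (w := fun _ ↦ (1 / n : ℝ))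
      (z := fun j ↦ f (X j ω)) (fun _ _ ↦ by positivity) (by simp [hn0])
      (fun j _ ↦ Set.mem_image_of_mem f (hω j))
    rw [← Finset.smul_sum, Complex.real_smul] at this
    rw [generatorAverage]
    convert this using 2
    push_cast
    rfl
  have hdiff : DifferentiableAt ℂ (generatorInv U f) (∫ ω, f (X 0 ω) ∂P) := by
    obtain ⟨z, hz, hzm⟩ := hCV hmean
    rw [← hzm]
    exact differentiableAt_invFunOn hf.isOpen hf.differentiableOn hf.injOn hz
  refine ⟨hint, hmean, havg, hdiff.restrictScalars ℝ, ?_⟩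
  refine tendstoInDistribution_delta hindep hident hL2 hV
    (continuousOn_invFunOn hf.isOpen hf.differentiableOn hf.injOn) (hCV hmean) hdiff fun n hn ↦ ?_
  filter_upwards [havg] with ω hω using hCV (hω n hn)
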